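/- Let $d\ge 1$ and put $p_i=1+y_i$ for $1\le i\le d$ and $q_j=1+y_j+y_jy_{j+1}$ for $1\le j\le d-1$ in $\mathbb C[y_1,\dots,y_d]$. Let $\mathcal U_d\subset(\mathbb C^*)^d$ (the open Pellspace) be the complement of the vanishing loci of the $p_i$ and $q_j$. Let $\Lambda$ be the group of Laurent monomials $z^{\alpha}=y^ap^bq^c=\prod_{i=1}^d y_i^{a_i}\prod_{i=1}^d p_i^{b_i}\prod_{j=1}^{d-1}q_j^{c_j}$, $\alpha=(a,b,c)\in\mathbb Z^d\times\mathbb Z^d\times\mathbb Z^{d-1}$, viewed as invertible regular functions on $\mathcal U_d$, and let $\Gamma\subset\Lambda$ be the semigroup (with identity) of those elements that are bounded on $\mathbb R_{>0}^d$. For a nonzero polynomial $F$ with non-negative coefficients and $Y\in\mathbb Z^d$ let $\operatorname{trop}(F)(Y)$ be the minimum of $\sum_i m_iY_i$ over the monomials $y^m$ occurring in $F$. Let $M_d$ be the $(3d-1)\times(3d-1)$ matrix with entries $\operatorname{trop}(F_i)(V_j)$, where $$(F_1,\dots,F_{3d-1})=(y_1,\dots,y_d,p_1,\dots,p_d,q_1,\dots,q_{d-1}),$$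 $$(V_1,\dots,V_{3d-1})=(e_1,\dots,e_d,-e_1,\dots,-e_d,e_1-e_2,\dots,e_{d-1}-e_d).$$ Then the following hold. 1. $M_d$ is invertible over $\mathbb Z$. If $\beta_i=(a_i,b_i,c_i)$, $1\le i\le 3d-1$, denote the rows of $M_d^{-1}$ and $u_i=z^{\beta_i}=y^{a_i}p^{b_i}q^{c_i}$, then $$u_i=\frac{y_ip_{i+1}}{q_i},\quad u_d=\frac{y_d}{p_d},\quad u_{d+1}=\frac1{p_1},\quad u_{d+1+i}=\frac{p_i}{q_i},\quad u_{2d+i}=\frac{q_i}{p_ip_{i+1}}\qquad(1\le i\le d-1).$$ 2. The $u_1,\dots,u_{3d-1}$ are the minimal generators of $\Gamma$: they are exactly the elements of $\Gamma\setminus\{1\}$ that are not a product of two elements of $\Gamma\setminus\{1\}$, they generate $\Gamma$, and every generating set of $\Gamma$ contains all of them. 3. $\Lambda$ is the character lattice of $\mathcal U_d$, that is, every invertible regular function on $\mathcal U_d$ can be written uniquely as a nonzero constant times an element of $\Lambda$; and $u_1,\dots,u_{3d-1}$ form a $\mathbb Z$-basis of $\Lambda$. -/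

import Mathlib

open MvPolynomial

/-- The polynomial ring `ℂ[y_1, …, y_d]`, where `d = n + 1` with `n : ℕ` (so `d` ranges over all
integers `≥ 1`). The variables are numbered from `0` to `n`. -/
abbrev PellPoly (n : ℕ) : Type := MvPolynomial (Fin (n + 1)) ℂ

/-- The index set with `3d - 1` elements: `d` elements `inl i` (for `y_i`, or the ray through
`e_i`), `d` elements `inr (inl i)` (for `p_i`, or the ray through `-e_i`), and `d - 1` elements
`inr (inr j)` (for `q_j`, or the ray through `e_j - e_{j+1}`). -/
abbrev PellIndex (n : ℕ) : Type := Fin (n + 1) ⊕ Fin (n + 1) ⊕ Fin n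

noncomputable section

/-- `p_i = 1 + y_i`. -/
def pellP (n : ℕ) (i : Fin (n + 1)) : PellPoly n := 1 + X i

/-- `q_j = 1 + y_j + y_j y_{j+1}`. -/
def pellQ (n : ℕ) (j : Fin n) : PellPoly n :=
  1 + X j.castSucc + X j.castSucc * X j.succ

/-- The tuple `F = (y_1, …, y_d, p_1, …, p_d, q_1, …, q_{d-1})`. -/
def pellF (n : ℕ) : PellIndex n → PellPoly n
  | .inl i => X i
  | .inr (.inl i) => pellP n i
  | .inr (.inr j) => pellQ n j

/-- The tuple `V = (e_1, …, e_d, -e_1, …, -e_d, e_1 - e_2, …, e_{d-1} - e_d)`. -/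
def pellRay (n : ℕ) : PellIndex n → Fin (n + 1) → ℤ
  | .inl i => Pi.single i 1
  | .inr (.inl i) => -Pi.single i 1
  | .inr (.inr j) => Pi.single j.castSucc 1 - Pi.single j.succ 1

/-- The tropicalization (min-plus convention) of a nonzero polynomial with positive coefficients,
evaluated at a lattice point `Y`: the minimum over the monomials `y^m` occurring in `F` of
`∑ i, m_i Y_i`. -/
def tropPoly {n : ℕ} (F : PellPoly n) (Y : Fin (n + 1) → ℤ) : ℤ :=
  ⨅ m : F.support, ∑ i, (m.1 i : ℤ) * Y i

/-- The matrix `M_d`, with entries `m_{ij} = trop(F_i)(V_j)`. -/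
def pellMatrix (n : ℕ) : Matrix (PellIndex n) (PellIndex n) ℤ :=
  Matrix.of fun i j => tropPoly (pellF n i) (pellRay n j)

/-- The open Pellspace: the points of the torus `(ℂ^*)^d` at which no `p_i` and no `q_j`
vanishes. -/
def openPellspace (n : ℕ) : Set (Fin (n + 1) → ℂ) :=
  {x | (∀ i, x i ≠ 0) ∧ (∀ i, eval x (pellP n i) ≠ 0) ∧ ∀ j, eval x (pellQ n j) ≠ 0}

/-- The product of all `y_i`, `p_i` and `q_j`; the open Pellspace is its non-vanishing locus in
`ℂ^d` (see `mem_openPellspace_iff`). -/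
def pellProd (n : ℕ) : PellPoly n := ∏ k, pellF n k

theorem mem_openPellspace_iff (n : ℕ) (x : Fin (n + 1) → ℂ) :
    x ∈ openPellspace n ↔ eval x (pellProd n) ≠ 0 := by
  simp [openPellspace, pellProd, pellF, Fintype.prod_sum_type, Finset.prod_ne_zero_iff,
    map_prod]

/-- The coordinate ring `ℂ[𝒰_d] = ℂ[y_1, …, y_d][y_i⁻¹, p_i⁻¹, q_j⁻¹]` of the open Pellspace. -/
abbrev PellRing (n : ℕ) : Type := Localization.Away (pellProd n)

/-- The value of a regular function at a point of the open Pellspace. -/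
def pellEval {n : ℕ} (x : openPellspace n) : PellRing n →+* ℂ :=
  IsLocalization.Away.lift (S := PellRing n) (g := eval (x : Fin (n + 1) → ℂ)) (pellProd n)
    (((mem_openPellspace_iff n x).1 x.2).isUnit)

theorem isUnit_pellF (n : ℕ) (k : PellIndex n) :
    IsUnit (algebraMap (PellPoly n) (PellRing n) (pellF n k)) :=
  isUnit_of_dvd_unit (map_dvd _ (Finset.dvd_prod_of_mem (pellF n) (Finset.mem_univ k)))
    (IsLocalization.Away.algebraMap_isUnit (pellProd n))

/-- The `F_k` (that is, `y_i`, `p_i` and `q_j`) as invertible regular functions on the open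
Pellspace. -/
def pellUnit (n : ℕ) (k : PellIndex n) : (PellRing n)ˣ := (isUnit_pellF n k).unit

/-- `y_i` as an invertible regular function. -/
def yUnit (n : ℕ) (i : Fin (n + 1)) : (PellRing n)ˣ := pellUnit n (.inl i)

/-- `p_i` as an invertible regular function. -/
def pUnit (n : ℕ) (i : Fin (n + 1)) : (PellRing n)ˣ := pellUnit n (.inr (.inl i))

/-- `q_j` as an invertible regular function. -/
def qUnit (n : ℕ) (j : Fin n) : (PellRing n)ˣ := pellUnit n (.inr (.inr j))

/-- The Laurent monomial `z^α = y^a p^b q^c` for `α = (a, b, c)`. -/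
def laurentMonomial (n : ℕ) (α : PellIndex n → ℤ) : (PellRing n)ˣ :=
  ∏ k, pellUnit n k ^ α k

/-- The nonzero constant functions. -/
def constUnit (n : ℕ) : ℂˣ →* (PellRing n)ˣ :=
  Units.map (algebraMap ℂ (PellRing n)).toMonoidHom

/-- The lattice `Λ` of Laurent monomials in the `y_i`, `p_i`, `q_j`. -/
def charLattice (n : ℕ) : Subgroup (PellRing n)ˣ where
  carrier := Set.range (laurentMonomial n)
  one_mem' := ⟨0, by simp [laurentMonomial]⟩
  mul_mem' := by
    rintro _ _ ⟨α, rfl⟩ ⟨β, rfl⟩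
    exact ⟨α + β, by simp [laurentMonomial, zpow_add, Finset.prod_mul_distrib]⟩
  inv_mem' := by
    rintro _ ⟨α, rfl⟩
    exact ⟨-α, by simp [laurentMonomial]⟩

theorem ofReal_mem_openPellspace {n : ℕ} (y : Fin (n + 1) → ℝ) (hy : ∀ i, 0 < y i) :
    (fun i => (y i : ℂ)) ∈ openPellspace n := by
  refine ⟨fun i => by simpa using (hy i).ne', fun i => ?_, fun j => ?_⟩
  · have h : (1 + y i : ℝ) ≠ 0 := by linarith [hy i] |> fun h : 0 < 1 + y i => h.ne'
    simp only [pellP, map_add, map_one, eval_X]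
    exact_mod_cast h
  · have h : (1 + y j.castSucc + y j.castSucc * y j.succ : ℝ) ≠ 0 := by
      have := hy j.castSucc
      have := hy j.succ
      positivity
    simp only [pellQ, map_add, map_mul, map_one, eval_X]
    exact_mod_cast h

/-- A regular function is bounded if it takes bounded values on the positive orthant
`ℝ_{>0}^d`. -/
def IsBoundedOnPositive {n : ℕ} (f : PellRing n) : Prop :=
  ∃ C : ℝ, ∀ (y : Fin (n + 1) → ℝ) (hy : ∀ i, 0 < y i),
    ‖pellEval ⟨fun i => (y i : ℂ), ofReal_mem_openPellspace y hy⟩ f‖ ≤ C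

/-- The semigroup (with identity) `Γ ⊆ Λ` of bounded characters. -/
def boundedChars (n : ℕ) : Submonoid (PellRing n)ˣ where
  carrier := {f | f ∈ charLattice n ∧ IsBoundedOnPositive (f : PellRing n)}
  one_mem' := ⟨one_mem _, 1, fun y hy => by simp⟩
  mul_mem' := by
    rintro f g ⟨hf, C, hC⟩ ⟨hg, D, hD⟩
    refine ⟨mul_mem hf hg, C * D, fun y hy => ?_⟩
    rw [Units.val_mul, map_mul, norm_mul]
    exact mul_le_mul (hC y hy) (hD y hy) (norm_nonneg _) ((norm_nonneg _).trans (hC y hy))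

/-- The elements of `Γ` other than `1` that are not a product of two elements of `Γ` other
than `1`. -/
def indecomposables {G : Type*} [CommGroup G] (Γ : Submonoid G) : Set G :=
  {u | u ∈ Γ ∧ u ≠ 1 ∧ ∀ w₁ ∈ Γ, ∀ w₂ ∈ Γ, u = w₁ * w₂ → w₁ = 1 ∨ w₂ = 1}

/-- The characters `u_i = z^{β_i}`, where `β_i` is the `i`-th row of `M_d⁻¹`. -/
def pellU (n : ℕ) (i : PellIndex n) : (PellRing n)ˣ :=
  laurentMonomial n ((pellMatrix n)⁻¹ i)

end

/-! ### Tropical values of the `F_k`. -/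

section Tropicalization

variable {n : ℕ}

/-! The heart of the proof is that Γ is a free commutative monoid on the `u_k`. Since M is
invertible, every Laurent monomial z^α is a product of the `u_k`, with exponent vector αM, so Γ only
has to be cut out by αM ≥ 0. Along the curve s ↦ s^V with V the `j`-th ray, `F_k` agrees with
s^trop(F_k)(V) up to a factor in [1, 3], so z^α behaves like s^((αM)_j) as s → 0. Boundedness
therefore forces αM ≥ 0 (`vecMul_nonneg_of_bounded`). Conversely each `u_k` is at most 1 on the
positive orthant (`pellU_mem_boundedChars`). Nonzero constants and their inverses are bounded, so a
Laurent monomial that is constant has αM = 0 and hence α = 0. This makes the `u_k` independent, and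
minimality is then a fact about ℕ^(3d-1). For the character lattice, the `F_k` are primes in a
polynomial ring: inverting their product creates only constants times Laurent monomials as units
(`exists_eq_constUnit_mul`). -/

theorem tropPoly_eq_of_support {F : PellPoly n} {Y : Fin (n + 1) → ℤ} {c : ℤ}
    (hle : ∀ m ∈ F.support, c ≤ ∑ i, (m i : ℤ) * Y i)
    (hex : ∃ m ∈ F.support, ∑ i, (m i : ℤ) * Y i = c) : tropPoly F Y = c := by
  obtain ⟨m, hm, rfl⟩ := hex
  -- `ℤ` is only conditionally complete, so the infimum is meaningful only over a nonempty family
  -- bounded below.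
  have : Nonempty F.support := ⟨⟨m, hm⟩⟩
  refine le_antisymm (ciInf_le (Set.finite_range _).bddBelow (⟨m, hm⟩ : F.support)) ?_
  exact le_ciInf fun m' => hle m'.1 m'.2

theorem sum_single_mul (i : Fin (n + 1)) (Y : Fin (n + 1) → ℤ) :
    ∑ k, ((Finsupp.single i 1 : Fin (n + 1) →₀ ℕ) k : ℤ) * Y k = Y i := by
  rw [Finset.sum_eq_single i]
  · simp
  · intro b _ hb
    simp [hb.symm]
  · simp

theorem sum_single_add_single_mul (i j : Fin (n + 1)) (Y : Fin (n + 1) → ℤ) :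
    ∑ k, ((Finsupp.single i 1 + Finsupp.single j 1 : Fin (n + 1) →₀ ℕ) k : ℤ) * Y k
      = Y i + Y j := by
  simp only [Finsupp.add_apply, Nat.cast_add, add_mul, Finset.sum_add_distrib, sum_single_mul]

theorem support_pellP (i : Fin (n + 1)) :
    (pellP n i).support = {0, Finsupp.single i 1} := by
  ext m
  simp only [mem_support_iff, pellP, coeff_add, coeff_one, coeff_X, Finset.mem_insert,
    Finset.mem_singleton]
  have : (0 : Fin (n + 1) →₀ ℕ) ≠ Finsupp.single i 1 := by simp [eq_comm]
  split_ifs <;> aesop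

theorem support_pellQ (j : Fin n) :
    (pellQ n j).support = {0, Finsupp.single j.castSucc 1,
      Finsupp.single j.castSucc 1 + Finsupp.single j.succ 1} := by
  have hX : (X j.castSucc * X j.succ : PellPoly n)
      = monomial (Finsupp.single j.castSucc 1 + Finsupp.single j.succ 1) 1 := by
    simp [X, monomial_mul]
  ext m
  simp only [mem_support_iff, pellQ, hX, coeff_add, coeff_one, coeff_X, coeff_monomial,
    Finset.mem_insert, Finset.mem_singleton]
  -- The three exponents are pairwise distinct, so no coefficients merge.
  have h1 : (0 : Fin (n + 1) →₀ ℕ) ≠ Finsupp.single j.castSucc 1 := by simp [eq_comm]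
  have h2 : (0 : Fin (n + 1) →₀ ℕ)
      ≠ Finsupp.single j.castSucc 1 + Finsupp.single j.succ 1 := by simp [eq_comm]
  have h3 : (Finsupp.single j.castSucc 1 : Fin (n + 1) →₀ ℕ)
      ≠ Finsupp.single j.castSucc 1 + Finsupp.single j.succ 1 := by simp
  by_cases e1 : 0 = m
  · subst e1
    rw [if_pos rfl, if_neg h1.symm, if_neg h2.symm]
    simp
  by_cases e2 : Finsupp.single j.castSucc 1 = m
  · subst e2
    rw [if_neg h1, if_pos rfl, if_neg h3.symm]
    simp
  · simp [e1, e2, eq_comm]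
    grind

theorem tropPoly_X (i : Fin (n + 1)) (Y : Fin (n + 1) → ℤ) :
    tropPoly (X i : PellPoly n) Y = Y i := by
  apply tropPoly_eq_of_support <;> simp [support_X, sum_single_mul]

theorem tropPoly_pellP (i : Fin (n + 1)) (Y : Fin (n + 1) → ℤ) :
    tropPoly (pellP n i) Y = min 0 (Y i) := by
  apply tropPoly_eq_of_support
  · simp [support_pellP, sum_single_mul]
  · simp only [support_pellP, Finset.mem_insert, Finset.mem_singleton, exists_eq_or_imp,
      exists_eq_left, sum_single_mul, Finsupp.coe_zero, Pi.zero_apply, Nat.cast_zero, zero_mul,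
      Finset.sum_const_zero]
    omega

theorem tropPoly_pellQ (j : Fin n) (Y : Fin (n + 1) → ℤ) :
    tropPoly (pellQ n j) Y = min 0 (min (Y j.castSucc) (Y j.castSucc + Y j.succ)) := by
  apply tropPoly_eq_of_support
  · simp only [support_pellQ, Finset.mem_insert, Finset.mem_singleton, forall_eq_or_imp,
      forall_eq, sum_single_mul, sum_single_add_single_mul, Finsupp.coe_zero, Pi.zero_apply,
      Nat.cast_zero, zero_mul, Finset.sum_const_zero]
    omega
  · simp only [support_pellQ, Finset.mem_insert, Finset.mem_singleton, exists_eq_or_imp,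
      exists_eq_left, sum_single_mul, sum_single_add_single_mul, Finsupp.coe_zero,
      Pi.zero_apply, Nat.cast_zero, zero_mul, Finset.sum_const_zero]
    omega

end Tropicalization

/-- The explicit inverse of the matrix `M_d`. -/
def pellMatrixInv (n : ℕ) : Matrix (PellIndex n) (PellIndex n) ℤ
  | .inl i => Fin.lastCases (motive := fun _ => PellIndex n → ℤ)
      (Pi.single (.inl (Fin.last n)) 1 - Pi.single (.inr (.inl (Fin.last n))) 1)
      (fun i => Pi.single (.inl i.castSucc) 1 + Pi.single (.inr (.inl i.succ)) 1
        - Pi.single (.inr (.inr i)) 1) i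
  | .inr (.inl i) => Fin.cases (motive := fun _ => PellIndex n → ℤ)
      (-Pi.single (.inr (.inl 0)) 1)
      (fun i => Pi.single (.inr (.inl i.castSucc)) 1 - Pi.single (.inr (.inr i)) 1) i
  | .inr (.inr i) => Pi.single (.inr (.inr i)) 1
      - (Pi.single (.inr (.inl i.castSucc)) 1 + Pi.single (.inr (.inl i.succ)) 1)

/-! ### Invertibility of `M_d`. -/

section Inverse

variable (n : ℕ)

theorem pellMatrixInv_y_castSucc (i : Fin n) :
    pellMatrixInv n (.inl i.castSucc) = Pi.single (.inl i.castSucc) 1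
      + Pi.single (.inr (.inl i.succ)) 1 - Pi.single (.inr (.inr i)) 1 := by
  simp [pellMatrixInv]

theorem pellMatrixInv_y_last :
    pellMatrixInv n (.inl (Fin.last n)) =
      Pi.single (.inl (Fin.last n)) 1 - Pi.single (.inr (.inl (Fin.last n))) 1 := by
  simp [pellMatrixInv]

theorem pellMatrixInv_p_zero :
    pellMatrixInv n (.inr (.inl 0)) = -Pi.single (.inr (.inl 0)) 1 := rfl

theorem pellMatrixInv_p_succ (i : Fin n) :
    pellMatrixInv n (.inr (.inl i.succ)) =
      Pi.single (.inr (.inl i.castSucc)) 1 - Pi.single (.inr (.inr i)) 1 := rfl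

theorem pellMatrixInv_q (i : Fin n) :
    pellMatrixInv n (.inr (.inr i)) = Pi.single (.inr (.inr i)) 1
      - (Pi.single (.inr (.inl i.castSucc)) 1 + Pi.single (.inr (.inl i.succ)) 1) := rfl

theorem pellMatrix_y (i : Fin (n + 1)) (k : PellIndex n) :
    pellMatrix n (.inl i) k = pellRay n k i := tropPoly_X i _

theorem pellMatrix_p (i : Fin (n + 1)) (k : PellIndex n) :
    pellMatrix n (.inr (.inl i)) k = min 0 (pellRay n k i) := tropPoly_pellP i _

theorem pellMatrix_q (j : Fin n) (k : PellIndex n) :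
    pellMatrix n (.inr (.inr j)) k =
      min 0 (min (pellRay n k j.castSucc) (pellRay n k j.castSucc + pellRay n k j.succ)) :=
  tropPoly_pellQ j _

/-- Each row of the product combines at most three rows of `pellMatrix`, whose entries are minima of
ray coordinates. Once the coincidences between indices are split, only integer arithmetic remains.
-/
theorem pellMatrixInv_mul : pellMatrixInv n * pellMatrix n = 1 := by
  ext i k
  rw [Matrix.mul_apply_eq_vecMul]
  rcases i with i | i | i
  · induction i using Fin.lastCases with
    | last =>
      rw [pellMatrixInv_y_last]
      simp only [Matrix.sub_vecMul, Matrix.single_one_vecMul, Pi.sub_apply, Matrix.row_apply,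
        pellMatrix_y, pellMatrix_p]
      rcases k with k | k | k <;>
      simp only [pellRay, Pi.single_apply, Pi.neg_apply, Pi.sub_apply, Matrix.one_apply,
        Sum.inl.injEq, Fin.ext_iff, Fin.val_last, Fin.val_castSucc, Fin.val_succ, reduceCtorEq, ↓reduceIte] <;>
      split_ifs <;> omega
    | cast i =>
      rw [pellMatrixInv_y_castSucc]
      simp only [Matrix.sub_vecMul, Matrix.add_vecMul, Matrix.single_one_vecMul, Pi.sub_apply,
        Pi.add_apply, Matrix.row_apply, pellMatrix_y, pellMatrix_p, pellMatrix_q]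
      rcases k with k | k | k <;>
      simp only [pellRay, Pi.single_apply, Pi.neg_apply, Pi.sub_apply, Matrix.one_apply,
        Sum.inl.injEq, Fin.ext_iff, Fin.val_castSucc, Fin.val_succ, reduceCtorEq, ↓reduceIte] <;>
      split_ifs <;> omega
  · induction i using Fin.cases with
    | zero =>
      rw [pellMatrixInv_p_zero]
      simp only [Matrix.neg_vecMul, Matrix.single_one_vecMul, Pi.neg_apply, Matrix.row_apply,
        pellMatrix_p]
      rcases k with k | k | k <;>
      simp only [pellRay, Pi.single_apply, Pi.neg_apply, Pi.sub_apply, Matrix.one_apply,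
        Sum.inl.injEq, Sum.inr.injEq, Fin.ext_iff, Fin.val_zero, Fin.val_castSucc, Fin.val_succ,
        reduceCtorEq, ↓reduceIte] <;>
      split_ifs <;> omega
    | succ i =>
      rw [pellMatrixInv_p_succ]
      simp only [Matrix.sub_vecMul, Matrix.single_one_vecMul, Pi.sub_apply,
        Matrix.row_apply, pellMatrix_p, pellMatrix_q]
      rcases k with k | k | k <;>
      simp only [pellRay, Pi.single_apply, Pi.neg_apply, Pi.sub_apply, Matrix.one_apply,
        Sum.inl.injEq, Sum.inr.injEq, Fin.ext_iff, Fin.val_castSucc, Fin.val_succ,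
        reduceCtorEq, ↓reduceIte] <;>
      split_ifs <;> omega
  · rw [pellMatrixInv_q]
    simp only [Matrix.sub_vecMul, Matrix.add_vecMul, Matrix.single_one_vecMul, Pi.sub_apply,
      Pi.add_apply, Matrix.row_apply, pellMatrix_p, pellMatrix_q]
    rcases k with k | k | k <;>
    simp only [pellRay, Pi.single_apply, Pi.neg_apply, Pi.sub_apply, Matrix.one_apply,
      Sum.inr.injEq, Fin.ext_iff, Fin.val_castSucc, Fin.val_succ, reduceCtorEq, ↓reduceIte] <;>
    split_ifs <;> omega

theorem isUnit_pellMatrix : IsUnit (pellMatrix n) :=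
  .of_mul_eq_one_right _ (pellMatrixInv_mul n)

theorem pellMatrix_inv : (pellMatrix n)⁻¹ = pellMatrixInv n :=
  Matrix.inv_eq_left_inv (pellMatrixInv_mul n)

theorem pellMatrix_mul_inv : pellMatrix n * pellMatrixInv n = 1 :=
  mul_eq_one_comm.1 (pellMatrixInv_mul n)

end Inverse

theorem zpow_sum {G ι : Type*} [CommGroup G] (g : G) (s : Finset ι) (f : ι → ℤ) :
    g ^ ∑ i ∈ s, f i = ∏ i ∈ s, g ^ f i := by
  classical
  induction s using Finset.induction_on with
  | empty => simp
  | insert a s ha ih => rw [Finset.sum_insert ha, Finset.prod_insert ha, zpow_add, ih]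

/-! ### The `u_k` as Laurent monomials, and the change of exponents. -/

section Monomials

variable (n : ℕ)

theorem laurentMonomial_add (α β : PellIndex n → ℤ) :
    laurentMonomial n (α + β) = laurentMonomial n α * laurentMonomial n β := by
  simp [laurentMonomial, zpow_add, Finset.prod_mul_distrib]

theorem laurentMonomial_sub (α β : PellIndex n → ℤ) :
    laurentMonomial n (α - β) = laurentMonomial n α / laurentMonomial n β := by
  simp [laurentMonomial, zpow_sub, Finset.prod_mul_distrib, div_eq_mul_inv]

theorem laurentMonomial_neg (α : PellIndex n → ℤ) :
    laurentMonomial n (-α) = (laurentMonomial n α)⁻¹ := by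
  simp [laurentMonomial]

theorem laurentMonomial_single (k : PellIndex n) :
    laurentMonomial n (Pi.single k 1) = pellUnit n k := by
  rw [laurentMonomial, Finset.prod_eq_single k]
  · simp
  · intro b _ hb
    simp [hb]
  · simp

theorem pellU_y_castSucc (i : Fin n) : pellU n (.inl i.castSucc)
    = yUnit n i.castSucc * pUnit n i.succ / qUnit n i := by
  rw [pellU, pellMatrix_inv, pellMatrixInv_y_castSucc, laurentMonomial_sub, laurentMonomial_add]
  simp only [laurentMonomial_single, yUnit, pUnit, qUnit]

theorem pellU_y_last : pellU n (.inl (Fin.last n))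
    = yUnit n (Fin.last n) / pUnit n (Fin.last n) := by
  rw [pellU, pellMatrix_inv, pellMatrixInv_y_last, laurentMonomial_sub]
  simp only [laurentMonomial_single, yUnit, pUnit]

theorem pellU_p_zero : pellU n (.inr (.inl 0)) = 1 / pUnit n 0 := by
  rw [pellU, pellMatrix_inv, pellMatrixInv_p_zero, laurentMonomial_neg, one_div]
  simp only [laurentMonomial_single, pUnit]

theorem pellU_p_succ (i : Fin n) :
    pellU n (.inr (.inl i.succ)) = pUnit n i.castSucc / qUnit n i := by
  rw [pellU, pellMatrix_inv, pellMatrixInv_p_succ, laurentMonomial_sub]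
  simp only [laurentMonomial_single, pUnit, qUnit]

theorem pellU_q (i : Fin n) : pellU n (.inr (.inr i))
    = qUnit n i / (pUnit n i.castSucc * pUnit n i.succ) := by
  rw [pellU, pellMatrix_inv, pellMatrixInv_q, laurentMonomial_sub, laurentMonomial_add]
  simp only [laurentMonomial_single, pUnit, qUnit]

/-- A product of the `u_i` is the Laurent monomial whose exponent is the corresponding
combination of the rows of `M_d⁻¹`. -/
theorem prod_pellU_zpow (t : PellIndex n → ℤ) :
    ∏ k, pellU n k ^ t k = laurentMonomial n (Matrix.vecMul t (pellMatrixInv n)) := by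
  simp only [pellU, pellMatrix_inv, laurentMonomial, Matrix.vecMul, dotProduct]
  simp_rw [← Finset.prod_zpow, ← zpow_mul]
  rw [Finset.prod_comm]
  refine Finset.prod_congr rfl fun k _ => ?_
  simp only [zpow_sum, mul_comm]

/-- The exponents αM are the tropical values of z^α at the rays, which is how boundedness will be
read off. -/
theorem laurentMonomial_eq_prod_pellU (α : PellIndex n → ℤ) :
    laurentMonomial n α = ∏ k, pellU n k ^ (Matrix.vecMul α (pellMatrix n)) k := by
  rw [prod_pellU_zpow, Matrix.vecMul_vecMul, pellMatrix_mul_inv, Matrix.vecMul_one]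

end Monomials

/-! ### Indecomposables and generators of a free commutative monoid. -/

section FreeMonoid

variable {G ι : Type*} [CommGroup G] [Fintype ι] [DecidableEq ι]

/-- In a product of generators equal to an indecomposable element, one of the two factors is always
trivial, so the induction ends at a single generator. -/
theorem indecomposables_subset_of_closure_eq {Γ : Submonoid G} {S : Set G}
    (hS : Submonoid.closure S = Γ) : indecomposables Γ ⊆ S := by
  rintro w ⟨hw, hw1, hdec⟩
  subst hS
  suffices h : ∀ x ∈ Submonoid.closure S, x ≠ 1 →
      (∀ w₁ ∈ Submonoid.closure S, ∀ w₂ ∈ Submonoid.closure S, x = w₁ * w₂ → w₁ = 1 ∨ w₂ = 1) →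
      x ∈ S from h w hw hw1 hdec
  intro x hx
  induction hx using Submonoid.closure_induction with
  | mem x hx => exact fun _ _ => hx
  | one => exact fun h => absurd rfl h
  | mul x y hx hy ihx ihy =>
    intro h hd
    rcases hd x hx y hy rfl with rfl | rfl
    · rw [one_mul] at h hd ⊢
      exact ihy h hd
    · rw [mul_one] at h hd ⊢
      exact ihx h hd

theorem prod_zpow_single (u : ι → G) (i : ι) :
    ∏ k, u k ^ (Pi.single i 1 : ι → ℤ) k = u i := by
  rw [Finset.prod_eq_single i]
  · simp
  · intro b _ hb
    simp [hb]
  · simp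

variable {u : ι → G} {Γ : Submonoid G}

/-- The hypotheses identify Γ with ℕ^ι, whose atoms are the unit vectors. -/
theorem range_eq_indecomposables
    (hinj : Function.Injective fun t : ι → ℤ => ∏ k, u k ^ t k)
    (hΓ : ∀ g, g ∈ Γ ↔ ∃ t : ι → ℤ, 0 ≤ t ∧ g = ∏ k, u k ^ t k) :
    Set.range u = indecomposables Γ := by
  have hmem : ∀ i, u i ∈ Γ := fun i =>
    (hΓ _).2 ⟨Pi.single i 1, Pi.single_nonneg.2 zero_le_one, (prod_zpow_single u i).symm⟩
  have hne : ∀ i, u i ≠ 1 := by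
    intro i h
    have : (Pi.single i 1 : ι → ℤ) = 0 := hinj (by simp [prod_zpow_single, h])
    simpa using congrFun this i
  ext w
  constructor
  · rintro ⟨i, rfl⟩
    refine ⟨hmem i, hne i, fun w₁ h₁ w₂ h₂ h => ?_⟩
    obtain ⟨t, ht, rfl⟩ := (hΓ _).1 h₁
    obtain ⟨s, hs, rfl⟩ := (hΓ _).1 h₂
    have hts : t + s = Pi.single i 1 := by
      apply hinj
      simp only [Pi.add_apply, zpow_add, Finset.prod_mul_distrib, prod_zpow_single, h]
    have hoff : ∀ k, k ≠ i → t k = 0 ∧ s k = 0 := by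
      intro k hk
      have h1 := congrFun hts k
      have h2 := ht k
      have h3 := hs k
      simp only [Pi.add_apply, Pi.single_eq_of_ne hk, Pi.zero_apply] at h1 h2 h3
      omega
    have hon := congrFun hts i
    have h2 := ht i
    have h3 := hs i
    simp only [Pi.add_apply, Pi.single_eq_same, Pi.zero_apply] at hon h2 h3
    rcases (by omega : t i = 0 ∨ s i = 0) with h0 | h0
    · left
      refine Finset.prod_eq_one fun k _ => ?_
      by_cases hk : k = i
      · simp [hk, h0]
      · simp [(hoff k hk).1]
    · right
      refine Finset.prod_eq_one fun k _ => ?_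
      by_cases hk : k = i
      · simp [hk, h0]
      · simp [(hoff k hk).2]
  · rintro ⟨hw, hw1, hdec⟩
    obtain ⟨t, ht, rfl⟩ := (hΓ _).1 hw
    have : ∃ i, 0 < t i := by
      by_contra! hcon
      exact hw1 (Finset.prod_eq_one fun k _ => by simp [le_antisymm (hcon k) (ht k)])
    obtain ⟨i, hi⟩ := this
    -- Since `t i` is positive, one factor `u i` splits off and the remaining exponents stay
    -- nonnegative.
    have hsplit : ∏ k, u k ^ t k = u i * ∏ k, u k ^ (t - Pi.single i 1 : ι → ℤ) k := by
      conv_lhs => rw [← add_sub_cancel (Pi.single i 1) t]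
      simp only [Pi.add_apply, zpow_add, Finset.prod_mul_distrib, prod_zpow_single]
    have hrest : (∏ k, u k ^ (t - Pi.single i 1 : ι → ℤ) k) ∈ Γ := by
      refine (hΓ _).2 ⟨_, fun k => ?_, rfl⟩
      by_cases hk : k = i
      · subst hk
        simp only [Pi.zero_apply, Pi.sub_apply, Pi.single_eq_same]
        omega
      · simpa [hk] using ht k
    rcases hdec _ (hmem i) _ hrest hsplit with h | h
    · exact absurd h (hne i)
    · exact ⟨i, by rw [hsplit, h, mul_one]⟩

theorem isLeast_range_generators
    (hinj : Function.Injective fun t : ι → ℤ => ∏ k, u k ^ t k)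
    (hΓ : ∀ g, g ∈ Γ ↔ ∃ t : ι → ℤ, 0 ≤ t ∧ g = ∏ k, u k ^ t k) :
    IsLeast {S : Set G | Submonoid.closure S = Γ} (Set.range u) := by
  have hrange := range_eq_indecomposables hinj hΓ
  refine ⟨le_antisymm ?_ ?_, fun S hS => hrange ▸ indecomposables_subset_of_closure_eq hS⟩
  · rw [Submonoid.closure_le, hrange]
    exact fun w hw => hw.1
  · intro w hw
    obtain ⟨t, ht, rfl⟩ := (hΓ _).1 hw
    refine prod_mem fun k _ => ?_
    obtain ⟨m, hm⟩ := Int.eq_ofNat_of_zero_le (ht k)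
    rw [hm, zpow_natCast]
    exact pow_mem (Submonoid.subset_closure (Set.mem_range_self k)) m

end FreeMonoid

/-! ### Growth along monomial curves and the description of Γ. -/

section Evaluation

variable {n : ℕ}

/-- The real-valued function on `ℝ^d` given by `F_k`. -/
def pellReal (k : PellIndex n) (y : Fin (n + 1) → ℝ) : ℝ :=
  match k with
  | .inl i => y i
  | .inr (.inl i) => 1 + y i
  | .inr (.inr j) => 1 + y j.castSucc + y j.castSucc * y j.succ

theorem pellReal_pos (k : PellIndex n) {y : Fin (n + 1) → ℝ} (hy : ∀ i, 0 < y i) :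
    0 < pellReal k y := by
  rcases k with i | i | j
  · exact hy i
  · have := hy i
    simp only [pellReal]
    positivity
  · have := hy j.castSucc
    have := hy j.succ
    simp only [pellReal]
    positivity

theorem eval_pellF (k : PellIndex n) (y : Fin (n + 1) → ℝ) :
    eval (fun i => (y i : ℂ)) (pellF n k) = pellReal k y := by
  rcases k with i | i | j <;> simp [pellF, pellP, pellQ, pellReal]

theorem pellEval_algebraMap (x : openPellspace n) (F : PellPoly n) :
    pellEval x (algebraMap _ _ F) = eval (x : Fin (n + 1) → ℂ) F := by
  simp [pellEval]

theorem norm_pellEval_laurentMonomial (α : PellIndex n → ℤ) {y : Fin (n + 1) → ℝ}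
    (hy : ∀ i, 0 < y i) :
    ‖pellEval ⟨fun i => (y i : ℂ), ofReal_mem_openPellspace y hy⟩
      (laurentMonomial n α : PellRing n)‖ = ∏ k, pellReal k y ^ α k := by
  set x : openPellspace n := ⟨fun i => (y i : ℂ), ofReal_mem_openPellspace y hy⟩
  have h1 : ∀ v : (PellRing n)ˣ,
      pellEval x (v : PellRing n) = (Units.map (pellEval x).toMonoidHom v : ℂˣ) := fun v => rfl
  have h2 : ∀ k, ((Units.map (pellEval x).toMonoidHom (pellUnit n k) : ℂˣ) : ℂ)
      = pellReal k y := by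
    intro k
    rw [← h1, ← eval_pellF]
    exact pellEval_algebraMap x _
  rw [h1, laurentMonomial, map_prod, Units.coe_prod, norm_prod]
  refine Finset.prod_congr rfl fun k _ => ?_
  rw [map_zpow, Units.val_zpow_eq_zpow_val, h2, norm_zpow, Complex.norm_real,
    Real.norm_of_nonneg (pellReal_pos k hy).le]

theorem isBoundedOnPositive_laurentMonomial_iff (α : PellIndex n → ℤ) :
    IsBoundedOnPositive (laurentMonomial n α : PellRing n) ↔
      ∃ C : ℝ, ∀ y : Fin (n + 1) → ℝ, (∀ i, 0 < y i) → ∏ k, pellReal k y ^ α k ≤ C := by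
  refine exists_congr fun C => forall_congr' fun y => forall_congr' fun hy => ?_
  rw [norm_pellEval_laurentMonomial α hy]

/-- Along the curve `s ↦ s^V`, the function `F_k` is comparable to `s ^ trop(F_k)(V)`. -/
theorem pellReal_curve_bounds (k : PellIndex n) (V : Fin (n + 1) → ℤ) {s : ℝ} (hs : 0 < s)
    (hs1 : s ≤ 1) :
    s ^ tropPoly (pellF n k) V ≤ pellReal k (fun i => s ^ V i) ∧
      pellReal k (fun i => s ^ V i) ≤ 3 * s ^ tropPoly (pellF n k) V := by
  have hpos : ∀ a : ℤ, 0 < s ^ a := fun a => zpow_pos hs a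
  -- As s ≤ 1, the monomial of least exponent dominates the others. It gives the lower bound by
  -- positivity, and the 3 counts the at most three monomials, all with coefficient 1.
  have hanti : ∀ {a b : ℤ}, a ≤ b → s ^ b ≤ s ^ a := fun h =>
    zpow_le_zpow_right_of_le_one₀ hs hs1 h
  rcases k with i | i | j
  · simp only [pellF, tropPoly_X, pellReal]
    constructor <;> linarith [hpos (V i)]
  · simp only [pellF, tropPoly_pellP, pellReal]
    set c := min 0 (V i) with hc
    have h0 : s ^ (0 : ℤ) ≤ s ^ c := hanti (by omega)
    have h1 : s ^ V i ≤ s ^ c := hanti (by omega)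
    have h2 := hpos (V i)
    have h3 := hpos c
    rw [zpow_zero] at h0
    refine ⟨?_, by linarith⟩
    rcases (by omega : c = 0 ∨ c = V i) with h | h <;> rw [h]
    · rw [zpow_zero]
      linarith
    · linarith
  · simp only [pellF, tropPoly_pellQ, pellReal, ← zpow_add₀ hs.ne']
    set c := min 0 (min (V j.castSucc) (V j.castSucc + V j.succ)) with hc
    have h0 : s ^ (0 : ℤ) ≤ s ^ c := hanti (by omega)
    have h1 : s ^ V j.castSucc ≤ s ^ c := hanti (by omega)
    have h2 : s ^ (V j.castSucc + V j.succ) ≤ s ^ c := hanti (by omega)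
    have h3 := hpos (V j.castSucc)
    have h4 := hpos (V j.castSucc + V j.succ)
    rw [zpow_zero] at h0
    refine ⟨?_, by linarith⟩
    rcases (by omega : c = 0 ∨ c = V j.castSucc ∨ c = V j.castSucc + V j.succ) with h | h | h <;>
      rw [h]
    · rw [zpow_zero]
      linarith
    · linarith
    · linarith

/-- Applied to the ratio of `F_k` to its tropical power. The bound must hold for exponents of either
sign, hence `natAbs`. -/
theorem inv_three_pow_le_zpow {r : ℝ} (h1 : 1 ≤ r) (h3 : r ≤ 3) (a : ℤ) :
    (3 ^ a.natAbs : ℝ)⁻¹ ≤ r ^ a := by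
  have hr : 0 < r := by linarith
  rcases Int.natAbs_eq a with h | h
  · rw [h, zpow_natCast, Int.natAbs_natCast]
    exact (inv_le_one_of_one_le₀ (one_le_pow₀ (by norm_num))).trans (one_le_pow₀ h1)
  · rw [h, zpow_neg, zpow_natCast, Int.natAbs_neg, Int.natAbs_natCast]
    gcongr

/-- On the curve attached to the `j`-th ray, z^α is at least c·s^((αM)_j) with c > 0 independent of
s. A negative exponent would make it blow up as s → 0. -/
theorem vecMul_nonneg_of_bounded {α : PellIndex n → ℤ}
    (h : IsBoundedOnPositive (laurentMonomial n α : PellRing n)) :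
    0 ≤ Matrix.vecMul α (pellMatrix n) := by
  obtain ⟨C, hC⟩ := (isBoundedOnPositive_laurentMonomial_iff α).1 h
  intro j
  by_contra! hneg
  simp only [Pi.zero_apply] at hneg
  set e := Matrix.vecMul α (pellMatrix n) j with he
  set c : ℝ := ∏ k, ((3 : ℝ) ^ (α k).natAbs)⁻¹ with hc
  have hcpos : 0 < c := Finset.prod_pos fun k _ => by positivity
  have key : ∀ s : ℝ, 0 < s → s ≤ 1 → c * s ^ e ≤ C := by
    intro s hs hs1
    refine le_trans ?_ (hC (fun i => s ^ pellRay n j i) fun i => zpow_pos hs _)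
    have hse : s ^ e = ∏ k, (s ^ pellMatrix n k j) ^ α k := by
      rw [he, Matrix.vecMul, dotProduct]
      -- `zpow_sum` is stated in a group, so it is applied in the units of ℝ.
      have := zpow_sum (Units.mk0 s hs.ne') Finset.univ fun k => α k * pellMatrix n k j
      have := congrArg (Units.val) this
      simp only [Units.coe_prod, Units.val_zpow_eq_zpow_val, Units.val_mk0] at this
      rw [this]
      refine Finset.prod_congr rfl fun k _ => ?_
      rw [← zpow_mul, mul_comm]
    rw [hc, hse, ← Finset.prod_mul_distrib]
    refine Finset.prod_le_prod (fun k _ => by positivity) fun k _ => ?_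
    obtain ⟨hl, hu⟩ := pellReal_curve_bounds k (pellRay n j) hs hs1
    change s ^ pellMatrix n k j ≤ _ at hl
    change _ ≤ 3 * s ^ pellMatrix n k j at hu
    have hp : 0 < s ^ pellMatrix n k j := zpow_pos hs _
    rw [← le_div_iff₀ (zpow_pos hp _), ← div_zpow]
    exact inv_three_pow_le_zpow ((one_le_div hp).2 hl) ((div_le_iff₀ hp).2 hu) _
  -- At s = 1/D the exponent e ≤ -1 gives c·s^e ≥ c·D > C, against `key`.
  set D : ℝ := max (C / c) 0 + 1 with hD
  have hD1 : 1 ≤ D := by linarith [le_max_right (C / c) 0]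
  have hDC : C / c < D := by linarith [le_max_left (C / c) 0]
  have h1 := key D⁻¹ (by positivity) (inv_le_one_of_one_le₀ hD1)
  have h2 : D ≤ D⁻¹ ^ e := by
    rw [inv_zpow']
    calc D = D ^ (1 : ℤ) := (zpow_one D).symm
      _ ≤ D ^ (-e) := zpow_le_zpow_right₀ hD1 (by omega)
  rw [div_lt_iff₀ hcpos] at hDC
  nlinarith [mul_le_mul_of_nonneg_left h2 hcpos.le]

theorem laurentMonomial_mem_charLattice (α : PellIndex n → ℤ) :
    laurentMonomial n α ∈ charLattice n := ⟨α, rfl⟩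

theorem prod_pellReal_add (α β : PellIndex n → ℤ) {y : Fin (n + 1) → ℝ} (hy : ∀ i, 0 < y i) :
    ∏ k, pellReal k y ^ (α + β) k = (∏ k, pellReal k y ^ α k) * ∏ k, pellReal k y ^ β k := by
  rw [← Finset.prod_mul_distrib]
  exact Finset.prod_congr rfl fun k _ => zpow_add₀ (pellReal_pos k hy).ne' _ _

theorem prod_pellReal_sub (α β : PellIndex n → ℤ) {y : Fin (n + 1) → ℝ} (hy : ∀ i, 0 < y i) :
    ∏ k, pellReal k y ^ (α - β) k = (∏ k, pellReal k y ^ α k) / ∏ k, pellReal k y ^ β k := by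
  rw [← Finset.prod_div_distrib]
  exact Finset.prod_congr rfl fun k _ => zpow_sub₀ (pellReal_pos k hy).ne' _ _

theorem prod_pellReal_neg (α : PellIndex n → ℤ) (y : Fin (n + 1) → ℝ) :
    ∏ k, pellReal k y ^ (-α) k = (∏ k, pellReal k y ^ α k)⁻¹ := by
  simp

theorem prod_pellReal_single (j : PellIndex n) (y : Fin (n + 1) → ℝ) :
    ∏ k, pellReal k y ^ (Pi.single j 1 : PellIndex n → ℤ) k = pellReal j y := by
  rw [Finset.prod_eq_single j]
  · simp
  · intro b _ hb
    simp [hb]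
  · simp

/-- Each `u_k` is a quotient of polynomials whose denominator minus numerator is a single monomial
with coefficient 1, so its values on the positive orthant are at most 1. -/
theorem pellU_mem_boundedChars (k : PellIndex n) : pellU n k ∈ boundedChars n := by
  refine ⟨laurentMonomial_mem_charLattice _, ?_⟩
  rw [pellU, pellMatrix_inv, isBoundedOnPositive_laurentMonomial_iff]
  refine ⟨1, fun y hy => ?_⟩
  rcases k with i | i | i
  · induction i using Fin.lastCases with
    | last =>
      rw [pellMatrixInv_y_last, prod_pellReal_sub _ _ hy, prod_pellReal_single,
        prod_pellReal_single, div_le_one (pellReal_pos _ hy)]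
      simp only [pellReal]
      linarith
    | cast i =>
      rw [pellMatrixInv_y_castSucc, prod_pellReal_sub _ _ hy, prod_pellReal_add _ _ hy,
        prod_pellReal_single, prod_pellReal_single, prod_pellReal_single,
        div_le_one (pellReal_pos _ hy)]
      simp only [pellReal]
      linarith
  · induction i using Fin.cases with
    | zero =>
      rw [pellMatrixInv_p_zero, prod_pellReal_neg, prod_pellReal_single]
      refine inv_le_one_of_one_le₀ ?_
      simp only [pellReal]
      linarith [hy 0]
    | succ i =>
      rw [pellMatrixInv_p_succ, prod_pellReal_sub _ _ hy, prod_pellReal_single,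
        prod_pellReal_single, div_le_one (pellReal_pos _ hy)]
      simp only [pellReal]
      nlinarith [mul_pos (hy i.castSucc) (hy i.succ)]
  · have hpos := mul_pos (pellReal_pos (.inr (.inl i.castSucc)) hy)
      (pellReal_pos (.inr (.inl i.succ)) hy)
    rw [pellMatrixInv_q, prod_pellReal_sub _ _ hy, prod_pellReal_add _ _ hy,
      prod_pellReal_single, prod_pellReal_single, prod_pellReal_single, div_le_one hpos]
    simp only [pellReal]
    nlinarith [hy i.succ]

theorem mem_boundedChars_iff (g : (PellRing n)ˣ) :
    g ∈ boundedChars n ↔ ∃ t : PellIndex n → ℤ, 0 ≤ t ∧ g = ∏ k, pellU n k ^ t k := by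
  constructor
  · rintro ⟨⟨α, rfl⟩, hb⟩
    exact ⟨_, vecMul_nonneg_of_bounded hb, laurentMonomial_eq_prod_pellU n α⟩
  · rintro ⟨t, ht, rfl⟩
    refine prod_mem fun k _ => ?_
    obtain ⟨m, hm⟩ := Int.eq_ofNat_of_zero_le (ht k)
    rw [hm, zpow_natCast]
    exact pow_mem (pellU_mem_boundedChars k) m

theorem norm_pellEval_constUnit (c : ℂˣ) (x : openPellspace n) :
    ‖pellEval x (constUnit n c : PellRing n)‖ = ‖(c : ℂ)‖ := by
  have : (constUnit n c : PellRing n) = algebraMap (PellPoly n) (PellRing n) (C (c : ℂ)) := by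
    change algebraMap ℂ (PellRing n) c = _
    rw [IsScalarTower.algebraMap_apply ℂ (PellPoly n) (PellRing n)]
    rfl
  rw [this, pellEval_algebraMap, eval_C]

theorem isBoundedOnPositive_constUnit (c : ℂˣ) :
    IsBoundedOnPositive (constUnit n c : PellRing n) :=
  ⟨‖(c : ℂ)‖, fun _ _ => (norm_pellEval_constUnit c _).le⟩

/-- A constant and its inverse are both bounded, so αM and its negative are both nonnegative. -/
theorem eq_zero_of_laurentMonomial_eq_constUnit {α : PellIndex n → ℤ} {c : ℂˣ}
    (h : laurentMonomial n α = constUnit n c) : α = 0 := by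
  have h1 : 0 ≤ Matrix.vecMul α (pellMatrix n) :=
    vecMul_nonneg_of_bounded (h ▸ isBoundedOnPositive_constUnit c)
  have h2 : 0 ≤ Matrix.vecMul (-α) (pellMatrix n) := by
    apply vecMul_nonneg_of_bounded
    rw [laurentMonomial_neg, h, ← map_inv]
    exact isBoundedOnPositive_constUnit _
  rw [Matrix.neg_vecMul, neg_nonneg] at h2
  have h3 := congrArg (fun v => Matrix.vecMul v (pellMatrixInv n)) (le_antisymm h2 h1)
  simpa [Matrix.vecMul_vecMul, pellMatrix_mul_inv] using h3

theorem laurentMonomial_injective : Function.Injective (laurentMonomial n) := by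
  intro α β h
  refine sub_eq_zero.1 (eq_zero_of_laurentMonomial_eq_constUnit (c := 1) ?_)
  rw [laurentMonomial_sub, h, div_self', map_one]

theorem prod_pellU_zpow_injective :
    Function.Injective fun t : PellIndex n → ℤ => ∏ k, pellU n k ^ t k := by
  intro t s h
  simp only [prod_pellU_zpow] at h
  have h3 := congrArg (fun v => Matrix.vecMul v (pellMatrix n)) (laurentMonomial_injective h)
  simpa [Matrix.vecMul_vecMul, pellMatrixInv_mul] using h3

end Evaluation

/-! ### Primality of the `F_k` and the units of the coordinate ring. -/

section Units

variable {n : ℕ}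

theorem isRelPrime_X_one_add_X (j : Fin (n + 1)) :
    IsRelPrime (X j : PellPoly n) (1 + X j) := by
  intro r h1 h2
  exact isUnit_of_dvd_one ((dvd_add_left h1).1 h2)

theorem irreducible_pellP (i : Fin (n + 1)) : Irreducible (pellP n i) := by
  have h := irreducible_mul_X_add (1 : PellPoly n) 1 i one_ne_zero (by simp) (by simp)
    isRelPrime_one_left
  rwa [one_mul, add_comm (X i)] at h

/-- q_j is linear in y_{j+1}, with coprime coefficients y_j and 1 + y_j that do not involve y_{j+1}.
-/
theorem irreducible_pellQ (j : Fin n) : Irreducible (pellQ n j) := by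
  have hne : j.succ ≠ j.castSucc := by simp [Fin.ext_iff]
  have h := irreducible_mul_X_add (X j.castSucc : PellPoly n) (1 + X j.castSucc) j.succ
    (X_ne_zero _) (by simpa using hne) (fun hmem => ?_) (isRelPrime_X_one_add_X _)
  · rwa [add_comm (_ * _)] at h
  · have := vars_add_subset _ _ hmem
    simp [hne] at this

theorem prime_pellF (k : PellIndex n) : Prime (pellF n k) := by
  rcases k with i | i | j
  · exact X_prime
  · exact (irreducible_pellP i).prime
  · exact (irreducible_pellQ j).prime

/-- A factor of a product of primes is a unit times a product of these primes. -/
theorem exists_unit_mul_prod_of_mul_eq {R ι : Type*} [CommRing R] [IsDomain R] {F : ι → R}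
    (hF : ∀ k, Prime (F k)) (s : Multiset ι) :
    ∀ a b : R, a * b = (s.map F).prod → ∃ (c : Rˣ) (t : Multiset ι), a = c * (t.map F).prod := by
  induction s using Multiset.induction_on with
  | empty =>
    intro a b h
    exact ⟨Units.mkOfMulEqOne a b (by simpa using h), 0, by
      rw [Multiset.map_zero, Multiset.prod_zero, mul_one]; rfl⟩
  | cons k s ih =>
    intro a b h
    rw [Multiset.map_cons, Multiset.prod_cons] at h
    rcases (hF k).dvd_or_dvd (Dvd.intro _ h.symm) with ⟨a', rfl⟩ | ⟨b', rfl⟩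
    -- The prime `F k` is cancelled from whichever factor it divides; it is recorded in `t` only
    -- when that factor is `a`.
    · obtain ⟨c, t, rfl⟩ := ih a' b (mul_left_cancel₀ (hF k).ne_zero (by rw [← h, mul_assoc]))
      exact ⟨c, k ::ₘ t, by rw [Multiset.map_cons, Multiset.prod_cons]; ring⟩
    · exact ih a b' (mul_left_cancel₀ (hF k).ne_zero (by rw [← h]; ring))

theorem exists_constUnit_of_isUnit (c : (PellPoly n)ˣ) :
    ∃ c' : ℂˣ, Units.map (algebraMap (PellPoly n) (PellRing n)).toMonoidHom c
      = constUnit n c' := by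
  obtain ⟨r, hr, hc⟩ := isUnit_iff_eq_C_of_isReduced.1 c.isUnit
  refine ⟨hr.unit, Units.ext ?_⟩
  change algebraMap (PellPoly n) (PellRing n) c = algebraMap ℂ (PellRing n) r
  rw [hc, IsScalarTower.algebraMap_apply ℂ (PellPoly n) (PellRing n)]
  rfl

theorem multiset_prod_pellUnit_mem_charLattice (t : Multiset (PellIndex n)) :
    (t.map (pellUnit n)).prod ∈ charLattice n := by
  refine Submonoid.multiset_prod_mem (charLattice n).toSubmonoid _ fun v hv => ?_
  obtain ⟨k, _, rfl⟩ := Multiset.mem_map.1 hv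
  exact ⟨Pi.single k 1, laurentMonomial_single n k⟩

theorem val_multiset_prod_pellUnit (t : Multiset (PellIndex n)) :
    ((t.map (pellUnit n)).prod : (PellRing n)ˣ)
      = algebraMap (PellPoly n) (PellRing n) (t.map (pellF n)).prod := by
  induction t using Multiset.induction_on with
  | empty => simp
  | cons k t ih =>
    simp only [Multiset.map_cons, Multiset.prod_cons, Units.val_mul, map_mul, ih]
    rfl

/-- Writing f = a / P^m with P the product of the `F_k`, the numerator becomes a unit after
inverting P, so it divides a power of P and is a constant times a product of the primes `F_k`. -/
theorem exists_eq_constUnit_mul (f : (PellRing n)ˣ) :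
    ∃ (c : ℂˣ), ∃ g ∈ charLattice n, f = constUnit n c * g := by
  obtain ⟨m, a, ha⟩ := IsLocalization.Away.surj (pellProd n) (f : PellRing n)
  have hprod : ∀ m : ℕ, pellProd n ^ m
      = ((m • (Finset.univ : Finset (PellIndex n)).val).map (pellF n)).prod := by
    intro m
    rw [Multiset.map_nsmul, Multiset.prod_nsmul]
    rfl
  have hunit : IsUnit (algebraMap (PellPoly n) (PellRing n) a) := by
    rw [← ha]
    exact f.isUnit.mul ((IsLocalization.Away.algebraMap_isUnit _).pow _)
  obtain ⟨l, b, hb⟩ := (IsLocalization.Away.algebraMap_isUnit_iff (pellProd n)).1 hunit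
  rw [hprod] at hb
  obtain ⟨c, t, hat⟩ := exists_unit_mul_prod_of_mul_eq prime_pellF _ a b hb.symm
  obtain ⟨c', hc'⟩ := exists_constUnit_of_isUnit c
  set s := m • (Finset.univ : Finset (PellIndex n)).val
  refine ⟨c', (t.map (pellUnit n)).prod / (s.map (pellUnit n)).prod,
    div_mem (multiset_prod_pellUnit_mem_charLattice t) (multiset_prod_pellUnit_mem_charLattice s), ?_⟩
  rw [← mul_div_assoc, eq_div_iff_mul_eq']
  apply Units.ext
  rw [← hc', Units.val_mul, Units.val_mul, val_multiset_prod_pellUnit,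
    val_multiset_prod_pellUnit, ← hprod, map_pow, ha, hat, map_mul]
  rfl

end Units

/-! ### Uniqueness of the decomposition and the ℤ-basis. -/

section Basis

variable (n : ℕ)

/-- Evaluation at (1, …, 1) shows this; it makes the map from ℂ injective, so that the constant in
the decomposition is unique. -/
instance nontrivial_pellRing : Nontrivial (PellRing n) :=
  (pellEval ⟨_, ofReal_mem_openPellspace (n := n) (fun _ => 1) fun _ => one_pos⟩).domain_nontrivial

theorem existsUnique_constUnit_mul (f : (PellRing n)ˣ) :
    ∃! c : ℂˣ × charLattice n, f = constUnit n c.1 * c.2 := by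
  obtain ⟨c, g, hg, rfl⟩ := exists_eq_constUnit_mul f
  refine ⟨(c, ⟨g, hg⟩), rfl, ?_⟩
  rintro ⟨c', ⟨g', hg'⟩⟩ h
  obtain ⟨α, rfl⟩ := hg
  obtain ⟨β, rfl⟩ := hg'
  simp only at h
  have hαβ : laurentMonomial n (β - α) = constUnit n (c / c') := by
    rw [laurentMonomial_sub, map_div, div_eq_div_iff_mul_eq_mul, mul_comm, h]
  obtain rfl : β = α := sub_eq_zero.1 (eq_zero_of_laurentMonomial_eq_constUnit hαβ)
  have hcc : constUnit n c = constUnit n c' := mul_right_cancel h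
  have hinj : Function.Injective (constUnit n) :=
    Units.map_injective (algebraMap ℂ (PellRing n)).injective
  rw [hinj hcc]

/-- The isomorphism from `ℤ^{3d-1}` to `Λ` that sends the unit vectors to the `u_i`. -/
noncomputable def pellUEquiv : (PellIndex n → ℤ) ≃+ Additive (charLattice n) :=
  AddEquiv.ofBijective
    (AddMonoidHom.mk' (fun t => Additive.ofMul
        (⟨∏ k, pellU n k ^ t k, _, (prod_pellU_zpow n t).symm⟩ : charLattice n))
      fun t s => by
        apply Additive.toMul.injective
        apply Subtype.ext
        simp only [Pi.add_apply, zpow_add, Finset.prod_mul_distrib, toMul_ofMul, toMul_add,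
          Subgroup.coe_mul])
    ⟨fun t s h => prod_pellU_zpow_injective
        (congrArg (fun v : Additive (charLattice n) => (v.toMul : (PellRing n)ˣ)) h),
      fun v => by
        obtain ⟨_, α, rfl⟩ := v
        exact ⟨Matrix.vecMul α (pellMatrix n),
          Subtype.ext (laurentMonomial_eq_prod_pellU n α).symm⟩⟩

theorem exists_basis_pellU : ∃ b : Module.Basis (PellIndex n) ℤ (Additive (charLattice n)),
    ∀ i, ((b i).toMul : (PellRing n)ˣ) = pellU n i := by
  refine ⟨(Pi.basisFun ℤ (PellIndex n)).map (pellUEquiv n).toIntLinearEquiv, fun i => ?_⟩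
  rw [Module.Basis.map_apply, Pi.basisFun_apply]
  exact prod_zpow_single (pellU n) i

end Basis

theorem mainTheorem5 (n : ℕ) :
    -- `M_d` is invertible over `ℤ`
    IsUnit (pellMatrix n) ∧
    -- explicit form of the `u_i`
    (∀ i : Fin n, pellU n (.inl i.castSucc)
      = yUnit n i.castSucc * pUnit n i.succ / qUnit n i) ∧
    pellU n (.inl (Fin.last n)) = yUnit n (Fin.last n) / pUnit n (Fin.last n) ∧
    pellU n (.inr (.inl 0)) = 1 / pUnit n 0 ∧
    (∀ i : Fin n, pellU n (.inr (.inl i.succ)) = pUnit n i.castSucc / qUnit n i) ∧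
    (∀ i : Fin n, pellU n (.inr (.inr i))
      = qUnit n i / (pUnit n i.castSucc * pUnit n i.succ)) ∧
    -- the `u_i` are the minimal generators of `Γ`: they are its indecomposable elements, and they
    -- form the least generating set
    Set.range (pellU n) = indecomposables (boundedChars n) ∧
    IsLeast {S : Set (PellRing n)ˣ | Submonoid.closure S = boundedChars n}
      (Set.range (pellU n)) ∧
    -- `Λ` is the character lattice of `𝒰_d`: each invertible regular function is, uniquely, a
    -- nonzero constant times an element of `Λ`
    (∀ f : (PellRing n)ˣ, ∃! c : ℂˣ × charLattice n, f = constUnit n c.1 * c.2) ∧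
    -- the `u_i` form a `ℤ`-basis of `Λ`
    ∃ b : Module.Basis (PellIndex n) ℤ (Additive (charLattice n)),
      ∀ i, ((b i).toMul : (PellRing n)ˣ) = pellU n i := by
  refine ⟨isUnit_pellMatrix n, pellU_y_castSucc n, pellU_y_last n, pellU_p_zero n,
    pellU_p_succ n, pellU_q n, ?_, ?_, existsUnique_constUnit_mul n, exists_basis_pellU n⟩
  · exact range_eq_indecomposables prod_pellU_zpow_injective mem_boundedChars_iff
  · exact isLeast_range_generators prod_pellU_zpow_injective mem_boundedChars_iff
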